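/- Theorem. Let $n\ge 3$ and let $M^n$ be a connected smooth (Hausdorff) manifold with a paracontact metric structure $(\phi,\xi,\eta,g)$; that is, $\phi$ is a smooth $(1,1)$-tensor field, $\xi$ a smooth vector field (the Reeb vector field), $\eta$ a smooth $1$-form and $g$ a smooth pseudo-Riemannian metric (a nondegenerate symmetric $(0,2)$-tensor field) such that $$\phi^2=I-\eta\otimes\xi,\quad \eta(\xi)=1,\quad \phi\xi=0,\quad \eta\circ\phi=0,\quad g(\phi X,\phi Y)=-g(X,Y)+\eta(X)\eta(Y),$$ and $g(X,\phi Y)=d\eta(X,Y)$ for all smooth vector fields $X,Y$, where $d\eta(X,Y)=\tfrac12\big(X(\eta(Y))-Y(\eta(X))-\eta([X,Y])\big)$. Let $r$ be the scalar curvature of $g$, and suppose that $g$ is a $\delta$-almost Yamabe soliton with potential vector field $Z$, that is, $Z$ is a smooth vector field, $\lambda:M\to\mathbb R$ is a smooth function, $\delta:M\to\mathbb R$ is a nowhere vanishing function, and $$\frac{\delta}{2}\,\mathfrak L_Z g=(r-\lambda)\,g .$$ Suppose that $Z=f\xi$ for a function $f:M\to\mathbb R$ that is not identically zero. Then $r=\lambda$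 on $M$, $f$ is constant, and $\xi$ is a Killing vector field, $\mathfrak L_\xi g=0$. Moreover $M$ is $K$-paracontact, that is, the tensor field $h=\tfrac12\mathfrak L_\xi\phi$ vanishes. -/

import Mathlib

open scoped Manifold ContDiff
open Bundle

noncomputable section

namespace Paracontact

section Basic

variable {n : ℕ} {M : Type*} [TopologicalSpace M] [ChartedSpace (EuclideanSpace ℝ (Fin n)) M]

/-- A (not necessarily continuous) vector field on `M`: a choice of a tangent vector at each
point. -/
abbrev VField (n : ℕ) (M : Type*) [TopologicalSpace M]
    [ChartedSpace (EuclideanSpace ℝ (Fin n)) M] : Type _ :=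
  (x : M) → TangentSpace (𝓡 n) x

/-- Smooth vector fields: smooth sections of the tangent bundle. -/
def IsSmoothField [IsManifold (𝓡 n) ∞ M] (X : VField n M) : Prop :=
  ContMDiff (𝓡 n) (𝓡 n).tangent ∞ (fun x : M => (⟨x, X x⟩ : TangentBundle (𝓡 n) M))

/-- The derivative `X(u)` of a function `u` along a vector field `X`. -/
def dirDeriv (X : VField n M) (u : M → ℝ) (x : M) : ℝ :=
  mvfderiv (𝓡 n) u x (X x)

/-- The Lie bracket `[X, Y]` of vector fields. -/
def bracket (X Y : VField n M) : VField n M :=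
  VectorField.mlieBracket (𝓡 n) X Y

variable (n M) in
/-- A smooth pseudo-Riemannian metric on `M`: a smooth symmetric `(0,2)`-tensor field which is
nondegenerate at every point. -/
structure PseudoRiemannianMetric [IsManifold (𝓡 n) ∞ M] where
  /-- the scalar product on each tangent space -/
  inner (x : M) : TangentSpace (𝓡 n) x →L[ℝ] TangentSpace (𝓡 n) x →L[ℝ] ℝ
  symm (x : M) (v w : TangentSpace (𝓡 n) x) : inner x v w = inner x w v
  nondegenerate (x : M) (v : TangentSpace (𝓡 n) x) (hv : ∀ w, inner x v w = 0) : v = 0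
  contMDiff : ContMDiff (𝓡 n)
    ((𝓡 n).prod 𝓘(ℝ, EuclideanSpace ℝ (Fin n) →L[ℝ] EuclideanSpace ℝ (Fin n) →L[ℝ] ℝ)) ∞
    (fun x => TotalSpace.mk' (EuclideanSpace ℝ (Fin n) →L[ℝ] EuclideanSpace ℝ (Fin n) →L[ℝ] ℝ)
      (E := fun x : M => TangentSpace (𝓡 n) x →L[ℝ] TangentSpace (𝓡 n) x →L[ℝ] ℝ) x (inner x))

variable [IsManifold (𝓡 n) ∞ M]

/-- The Lie derivative of the metric along `Z`:
`(L_Z g)(X, Y) = Z(g(X, Y)) - g([Z, X], Y) - g(X, [Z, Y])`. -/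
def lieDerivMetric (g : PseudoRiemannianMetric n M) (Z X Y : VField n M) (x : M) : ℝ :=
  dirDeriv Z (fun y => g.inner y (X y) (Y y)) x
    - g.inner x (bracket Z X x) (Y x) - g.inner x (X x) (bracket Z Y x)

/-- A vector field `Z` is Killing when `L_Z g = 0`. -/
def IsKilling (g : PseudoRiemannianMetric n M) (Z : VField n M) : Prop :=
  ∀ X Y : VField n M, IsSmoothField X → IsSmoothField Y → ∀ x, lieDerivMetric g Z X Y x = 0

end Basic

section Curvature

variable {n : ℕ}

/-- The partial derivative `∂ᵢ u` on `ℝⁿ`. -/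
def partialDeriv (i : Fin n) (u : EuclideanSpace ℝ (Fin n) → ℝ) (y : EuclideanSpace ℝ (Fin n)) :
    ℝ :=
  fderiv ℝ u y (EuclideanSpace.single i 1)

/-- The Christoffel symbols `Γᵏᵢⱼ = ½ ∑ₗ Gᵏˡ (∂ᵢ Gⱼₗ + ∂ⱼ Gᵢₗ - ∂ₗ Gᵢⱼ)` of the Levi-Civita
connection of a metric with component matrix `G`. -/
def christoffel (G : EuclideanSpace ℝ (Fin n) → Matrix (Fin n) (Fin n) ℝ) (k i j : Fin n)
    (y : EuclideanSpace ℝ (Fin n)) : ℝ :=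
  (1 / 2) * ∑ l, (G y)⁻¹ k l *
    (partialDeriv i (fun z => G z j l) y + partialDeriv j (fun z => G z i l) y
      - partialDeriv l (fun z => G z i j) y)

/-- The components `Rˡₖᵢⱼ` of the Riemann curvature tensor
`R(X, Y) = [∇_X, ∇_Y] - ∇_[X, Y]`, that is `R(∂ᵢ, ∂ⱼ) ∂ₖ = ∑ₗ Rˡₖᵢⱼ ∂ₗ`. -/
def riemannComponent (G : EuclideanSpace ℝ (Fin n) → Matrix (Fin n) (Fin n) ℝ) (l k i j : Fin n)
    (y : EuclideanSpace ℝ (Fin n)) : ℝ :=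
  partialDeriv i (christoffel G l j k) y - partialDeriv j (christoffel G l i k) y
    + ∑ m, (christoffel G l i m y * christoffel G m j k y
      - christoffel G l j m y * christoffel G m i k y)

/-- The components of the Ricci tensor, `S(Y, Z) = trace (X ↦ R(X, Y) Z)`. -/
def ricciComponent (G : EuclideanSpace ℝ (Fin n) → Matrix (Fin n) (Fin n) ℝ) (j k : Fin n)
    (y : EuclideanSpace ℝ (Fin n)) : ℝ :=
  ∑ i, riemannComponent G i k i j y

/-- The scalar curvature `∑ⱼₖ Gʲᵏ Sⱼₖ` in coordinates. -/
def scalarCurvatureCoord (G : EuclideanSpace ℝ (Fin n) → Matrix (Fin n) (Fin n) ℝ)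
    (y : EuclideanSpace ℝ (Fin n)) : ℝ :=
  ∑ j, ∑ k, (G y)⁻¹ j k * ricciComponent G j k y

variable {M : Type*} [TopologicalSpace M] [ChartedSpace (EuclideanSpace ℝ (Fin n)) M]

/-- The coordinate vector field `∂ᵢ` of the preferred chart at `p`, at the point with
coordinates `y`. -/
def coordVector (p : M) (i : Fin n) (y : EuclideanSpace ℝ (Fin n)) :
    TangentSpace (𝓡 n) ((extChartAt (𝓡 n) p).symm y) :=
  mfderiv 𝓘(ℝ, EuclideanSpace ℝ (Fin n)) (𝓡 n) (extChartAt (𝓡 n) p).symm y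
    (EuclideanSpace.single i 1 : EuclideanSpace ℝ (Fin n))

variable [IsManifold (𝓡 n) ∞ M]

/-- The component matrix `Gᵢⱼ = g(∂ᵢ, ∂ⱼ)` of the metric in the preferred chart at `p`. -/
def coordMetric (g : PseudoRiemannianMetric n M) (p : M) (y : EuclideanSpace ℝ (Fin n)) :
    Matrix (Fin n) (Fin n) ℝ :=
  Matrix.of fun i j =>
    g.inner ((extChartAt (𝓡 n) p).symm y) (coordVector p i y) (coordVector p j y)

/-- The scalar curvature `r` of `g`. It does not depend on coordinates; at `p` it is computed in
the preferred chart at `p`. -/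
def scalarCurvature (g : PseudoRiemannianMetric n M) (p : M) : ℝ :=
  scalarCurvatureCoord (coordMetric g p) (extChartAt (𝓡 n) p p)

end Curvature

section Structures

variable (n : ℕ) (M : Type*) [TopologicalSpace M] [ChartedSpace (EuclideanSpace ℝ (Fin n)) M]
  [IsManifold (𝓡 n) ∞ M]

/-- An almost paracontact metric structure `(φ, ξ, η, g)` on `M`. -/
structure AlmostParacontactMetric where
  /-- the `(1,1)`-tensor field -/
  φ (x : M) : TangentSpace (𝓡 n) x →L[ℝ] TangentSpace (𝓡 n) x
  /-- the Reeb vector field -/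
  ξ : VField n M
  /-- the 1-form -/
  η (x : M) : TangentSpace (𝓡 n) x →L[ℝ] ℝ
  /-- the compatible pseudo-Riemannian metric -/
  g : PseudoRiemannianMetric n M
  smooth_φ : ContMDiff (𝓡 n)
    ((𝓡 n).prod 𝓘(ℝ, EuclideanSpace ℝ (Fin n) →L[ℝ] EuclideanSpace ℝ (Fin n))) ∞
    (fun x => TotalSpace.mk' (EuclideanSpace ℝ (Fin n) →L[ℝ] EuclideanSpace ℝ (Fin n))
      (E := fun x : M => TangentSpace (𝓡 n) x →L[ℝ] TangentSpace (𝓡 n) x) x (φ x))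
  smooth_ξ : IsSmoothField ξ
  smooth_η : ContMDiff (𝓡 n)
    ((𝓡 n).prod 𝓘(ℝ, EuclideanSpace ℝ (Fin n) →L[ℝ] ℝ)) ∞
    (fun x => TotalSpace.mk' (EuclideanSpace ℝ (Fin n) →L[ℝ] ℝ)
      (E := fun x : M => TangentSpace (𝓡 n) x →L[ℝ] ℝ) x (η x))
  φ_sq (x : M) (v : TangentSpace (𝓡 n) x) : φ x (φ x v) = v - η x v • ξ x
  η_ξ (x : M) : η x (ξ x) = 1
  φ_ξ (x : M) : φ x (ξ x) = 0
  η_φ (x : M) (v : TangentSpace (𝓡 n) x) : η x (φ x v) = 0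
  compatible (x : M) (v w : TangentSpace (𝓡 n) x) :
    g.inner x (φ x v) (φ x w) = - g.inner x v w + η x v * η x w

variable {n M}

/-- The exterior derivative of a 1-form,
`dη(X, Y) = ½ (X(η(Y)) - Y(η(X)) - η([X, Y]))`. -/
def extDerivOneForm (η : (x : M) → TangentSpace (𝓡 n) x →L[ℝ] ℝ) (X Y : VField n M) (x : M) : ℝ :=
  (1 / 2) * (dirDeriv X (fun y => η y (Y y)) x - dirDeriv Y (fun y => η y (X y)) x
    - η x (bracket X Y x))

namespace AlmostParacontactMetric

/-- The fundamental 2-form `Φ(X, Y) = g(X, φ Y)`. -/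
def fundamentalForm (S : AlmostParacontactMetric n M) (X Y : VField n M) (x : M) : ℝ :=
  S.g.inner x (X x) (S.φ x (Y x))

/-- The structure is a paracontact metric structure when `Φ = dη`. -/
def IsParacontactMetric (S : AlmostParacontactMetric n M) : Prop :=
  ∀ X Y : VField n M, IsSmoothField X → IsSmoothField Y →
    ∀ x, S.fundamentalForm X Y x = extDerivOneForm S.η X Y x

/-- The operator `h = ½ L_ξ φ`, that is `h X = ½ ([ξ, φ X] - φ [ξ, X])`. -/
def h (S : AlmostParacontactMetric n M) (X : VField n M) : VField n M :=
  fun x => (1 / 2 : ℝ) • (bracket S.ξ (fun y => S.φ y (X y)) x - S.φ x (bracket S.ξ X x))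

/-- A K-paracontact structure: a paracontact metric structure with `h = 0`. -/
def IsKParacontact (S : AlmostParacontactMetric n M) : Prop :=
  S.IsParacontactMetric ∧ ∀ X : VField n M, IsSmoothField X → ∀ x, S.h X x = 0

end AlmostParacontactMetric

/-- `(g, Z, lam, δ)` is a δ-almost Yamabe soliton with potential vector field `Z`:
`Z` and `lam` are smooth, `δ` vanishes nowhere, and `(δ/2) L_Z g = (r - lam) g`. -/
structure IsDeltaAlmostYamabeSoliton (g : PseudoRiemannianMetric n M) (Z : VField n M)
    (lam δ : M → ℝ) : Prop where
  smooth_Z : IsSmoothField Z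
  smooth_lam : ContMDiff (𝓡 n) 𝓘(ℝ, ℝ) ∞ lam
  δ_ne_zero (x : M) : δ x ≠ 0
  equation (X Y : VField n M) (hX : IsSmoothField X) (hY : IsSmoothField Y) (x : M) :
    δ x / 2 * lieDerivMetric g Z X Y x = (scalarCurvature g x - lam x) * g.inner x (X x) (Y x)

end Structures

end Paracontact

end

namespace Paracontact

/-! ### Calculus of smooth vector fields -/

section VectorFields

variable {n : ℕ} {M : Type*} [TopologicalSpace M] [ChartedSpace (EuclideanSpace ℝ (Fin n)) M]

/-! For `Z = f ξ`, `L_Z g` is `f L_ξ g + df ⊗ η + η ⊗ df`. Since `dη(ξ, ·) = 0` and `η(ξ) = 1`, `L_ξ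
η = 0`, so `L_ξ g` vanishes when one argument is `ξ` (`lieDerivMetric_ξ_ξ`). Evaluating the soliton
equation on `(ξ, ξ)` and `(ξ, X)` then yields `δ ξ(f) = r - λ` and `df = ξ(f) η`. The contact
condition rules out `ξ(f) ≠ 0`: brackets of fields in `ker η` leave `ker η` at every point, because
`dη = Φ` is nonzero there (`IsParacontactMetric.dirDeriv_eq_zero`). Hence `df = 0`, `r = λ`, and the
equation reduces to `f L_ξ g = 0` with `f` a nonzero constant. Finally `ξ` preserves `Φ = g(·, φ
·)`; preserving `g` as well, it preserves `φ`, so `h = 0`. -/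

theorem dirDeriv_const (X : VField n M) (c : ℝ) (x : M) :
    dirDeriv X (fun _ : M => c) x = 0 := by
  simp [dirDeriv, mvfderiv_const]

theorem dirDeriv_sub (X : VField n M) {u v : M → ℝ} (hu : ContMDiff (𝓡 n) 𝓘(ℝ, ℝ) ∞ u)
    (hv : ContMDiff (𝓡 n) 𝓘(ℝ, ℝ) ∞ v) (x : M) :
    dirDeriv X (fun y => u y - v y) x = dirDeriv X u x - dirDeriv X v x :=
  congrArg (fun L => L (X x))
    (mvfderiv_sub (hu.mdifferentiable (by simp) x) (hv.mdifferentiable (by simp) x))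

theorem dirDeriv_const_mul (X : VField n M) (c : ℝ) {u : M → ℝ}
    (hu : ContMDiff (𝓡 n) 𝓘(ℝ, ℝ) ∞ u) (x : M) :
    dirDeriv X (fun y => c * u y) x = c * dirDeriv X u x := by
  have h := congrArg (fun L => L (X x)) (mvfderiv_fun_mul (I := 𝓡 n)
    (mdifferentiableAt_const (c := c)) (hu.mdifferentiable (by simp) x))
  simpa [dirDeriv, mvfderiv_const] using h

variable [IsManifold (𝓡 n) ∞ M]

theorem IsSmoothField.mdifferentiableAt {X : VField n M} (hX : IsSmoothField X) (x : M) :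
    MDifferentiableAt (𝓡 n) (𝓡 n).tangent (fun y : M => (⟨y, X y⟩ : TangentBundle (𝓡 n) M)) x :=
  ContMDiff.mdifferentiable hX (by simp) x

theorem IsSmoothField.smul {u : M → ℝ} {X : VField n M} (hu : ContMDiff (𝓡 n) 𝓘(ℝ, ℝ) ∞ u)
    (hX : IsSmoothField X) : IsSmoothField (u • X) :=
  ContMDiff.smul_section hu hX

theorem IsSmoothField.bracket {X Y : VField n M} (hX : IsSmoothField X) (hY : IsSmoothField Y) :
    IsSmoothField (bracket X Y) := by
  have : IsManifold (𝓡 n) (((⊤ : ℕ∞) : WithTop ℕ∞) + 1) M := by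
    simpa using (inferInstance : IsManifold (𝓡 n) ∞ M)
  have : IsManifold (𝓡 n) (minSmoothness ℝ 2) M := by
    rw [minSmoothness_of_isRCLikeNormedField]
    infer_instance
  exact ContDiff.mlieBracket_vectorField (m := ⊤) (n := ⊤) hX hY (by simp)

theorem bracket_jacobi {U V W : VField n M} (hU : IsSmoothField U) (hV : IsSmoothField V)
    (hW : IsSmoothField W) (x : M) :
    bracket U (bracket V W) x = bracket (bracket U V) W x + bracket V (bracket U W) x := by
  have : IsManifold (𝓡 n) (minSmoothness ℝ 3) M := by
    rw [minSmoothness_of_isRCLikeNormedField]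
    infer_instance
  have h2 : minSmoothness ℝ 2 ≤ (∞ : WithTop ℕ∞) := by
    rw [minSmoothness_of_isRCLikeNormedField]
    exact ENat.LEInfty.out
  exact VectorField.leibniz_identity_mlieBracket_apply
    ((hU x).of_le h2) ((hV x).of_le h2) ((hW x).of_le h2)

theorem bracket_smul_right (V : VField n M) {W : VField n M} {u : M → ℝ}
    (hu : ContMDiff (𝓡 n) 𝓘(ℝ, ℝ) ∞ u) (hW : IsSmoothField W) (x : M) :
    bracket V (u • W) x = dirDeriv V u x • W x + u x • bracket V W x :=
  VectorField.mlieBracket_smul_right (hu.mdifferentiable (by simp) x) (hW.mdifferentiableAt x)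

theorem bracket_smul_left {V : VField n M} (W : VField n M) {u : M → ℝ}
    (hu : ContMDiff (𝓡 n) 𝓘(ℝ, ℝ) ∞ u) (hV : IsSmoothField V) (x : M) :
    bracket (u • V) W x = -dirDeriv W u x • V x + u x • bracket V W x :=
  VectorField.mlieBracket_smul_left (hu.mdifferentiable (by simp) x) (hV.mdifferentiableAt x)

theorem bracket_add_right (V : VField n M) {W W' : VField n M} (hW : IsSmoothField W)
    (hW' : IsSmoothField W') (x : M) :
    bracket V (W + W') x = bracket V W x + bracket V W' x :=
  VectorField.mlieBracket_add_right (hW.mdifferentiableAt x) (hW'.mdifferentiableAt x)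

theorem contMDiff_dirDeriv {X : VField n M} {u : M → ℝ}
    (hX : IsSmoothField X) (hu : ContMDiff (𝓡 n) 𝓘(ℝ, ℝ) ∞ u) :
    ContMDiff (𝓡 n) 𝓘(ℝ, ℝ) ∞ (dirDeriv X u) := by
  exact (contMDiff_snd_tangentBundle_modelSpace ℝ 𝓘(ℝ, ℝ)).comp
    ((hu.contMDiff_tangentMap (m := ∞) (by simp)).comp hX)

/-- A local extension is cut off by a bump function. This turns identities between fields into
identities between tangent vectors. -/
theorem exists_isSmoothField_apply_eq [T2Space M] (x : M) (v : TangentSpace (𝓡 n) x) :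
    ∃ X : VField n M, IsSmoothField X ∧ X x = v := by
  obtain ⟨s, hs, hsm⟩ := FiberBundle.exists_contMDiffOn_extend (k := ∞) (𝓡 n)
    (EuclideanSpace ℝ (Fin n)) (V := (TangentSpace (𝓡 n) : M → Type)) v
  obtain ⟨ψ, -, hψ⟩ :=
    (SmoothBumpFunction.nhds_basis_tsupport (I := 𝓡 n) x).mem_iff.1 (interior_mem_nhds.2 hs)
  refine ⟨(ψ : M → ℝ) • FiberBundle.extend (EuclideanSpace ℝ (Fin n)) v,
    ContMDiffOn.smul_section_of_tsupport ψ.contMDiff.contMDiffOn isOpen_interior hψ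
      (hsm.mono interior_subset), ?_⟩
  simp

/-- Expand the Jacobi identity for `X`, `Y`, `u • W` by the Leibniz rule, subtract `u` times the one
for `X`, `Y`, `W`, and compare coefficients of `W`. -/
theorem dirDeriv_bracket [T2Space M] {X Y : VField n M} {u : M → ℝ}
    (hX : IsSmoothField X) (hY : IsSmoothField Y) (hu : ContMDiff (𝓡 n) 𝓘(ℝ, ℝ) ∞ u) (x : M) :
    dirDeriv (bracket X Y) u x = dirDeriv X (dirDeriv Y u) x - dirDeriv Y (dirDeriv X u) x := by
  -- Cancelling `W x` needs a nonzero tangent vector; without one, every derivative at `x` is zero.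
  by_cases hv : ∃ v : TangentSpace (𝓡 n) x, v ≠ 0
  · obtain ⟨v, hv⟩ := hv
    obtain ⟨W, hW, rfl⟩ := exists_isSmoothField_apply_eq x v
    have hXu := contMDiff_dirDeriv hX hu
    have hYu := contMDiff_dirDeriv hY hu
    have key : ∀ {V : VField n M}, IsSmoothField V →
        bracket V (u • W) = dirDeriv V u • W + u • bracket V W :=
      fun hV => funext fun y => bracket_smul_right _ hu hW y
    have hJ := bracket_jacobi hX hY (hW.smul hu) x
    have hJ' := bracket_jacobi hX hY hW x
    rw [key hY, key hX, bracket_smul_right _ hu hW,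
      bracket_add_right _ (hW.smul hYu) ((hY.bracket hW).smul hu),
      bracket_add_right _ (hW.smul hXu) ((hX.bracket hW).smul hu),
      bracket_smul_right _ hYu hW, bracket_smul_right _ hXu hW,
      bracket_smul_right _ hu (hY.bracket hW), bracket_smul_right _ hu (hX.bracket hW), hJ',
      ← sub_eq_zero] at hJ
    have : (dirDeriv X (dirDeriv Y u) x - dirDeriv Y (dirDeriv X u) x
        - dirDeriv (bracket X Y) u x) • W x = 0 := by
      rw [← hJ]
      module
    linarith [(smul_eq_zero.1 this).resolve_right hv]
  · push Not at hv
    simp [dirDeriv, hv]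

/-- Smooth fields reach every tangent vector, so `du = 0`; read on a ball in a chart, `u` is locally
constant. -/
theorem exists_eq_const_of_dirDeriv_eq_zero [T2Space M] [PreconnectedSpace M] [Nonempty M]
    {u : M → ℝ} (hu : ContMDiff (𝓡 n) 𝓘(ℝ, ℝ) ∞ u)
    (h : ∀ X : VField n M, IsSmoothField X → ∀ x, dirDeriv X u x = 0) :
    ∃ c, ∀ x, u x = c := by
  have hd : ∀ x, mfderiv (𝓡 n) 𝓘(ℝ, ℝ) u x = 0 := by
    intro x
    ext v
    obtain ⟨X, hX, rfl⟩ := exists_isSmoothField_apply_eq x v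
    exact h X hX x
  have hloc : IsLocallyConstant u := by
    rw [IsLocallyConstant.iff_eventually_eq]
    intro x
    set e := extChartAt (𝓡 n) x with he
    obtain ⟨r, hr, hball⟩ := Metric.isOpen_iff.1 (isOpen_extChartAt_target (I := 𝓡 n) x) (e x)
      (mem_extChartAt_target x)
    have hder : ∀ y ∈ Metric.ball (e x) r, HasFDerivAt (u ∘ e.symm)
        (0 : EuclideanSpace ℝ (Fin n) →L[ℝ] ℝ) y := by
      intro y hy
      have h1 := (mdifferentiableWithinAt_extChartAt_symm (I := 𝓡 n) (hball hy)).mdifferentiableAt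
        (by simp)
      have h2 := ((hu.mdifferentiable (by simp) (e.symm y)).hasMFDerivAt).comp y h1.hasMFDerivAt
      rw [hd] at h2
      exact h2.hasFDerivAt.congr_fderiv (ContinuousLinearMap.zero_comp _)
    have hconst : ∀ y ∈ Metric.ball (e x) r, (u ∘ e.symm) y = (u ∘ e.symm) (e x) := by
      intro y hy
      refine Metric.isOpen_ball.is_const_of_fderiv_eq_zero (𝕜 := ℝ)
        (convex_ball (e x) r).isPreconnected
        (fun z hz => (hder z hz).differentiableAt.differentiableWithinAt)
        (fun z hz => (hder z hz).fderiv) hy (Metric.mem_ball_self hr)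
    filter_upwards [extChartAt_source_mem_nhds (I := 𝓡 n) x,
      (continuousAt_extChartAt (I := 𝓡 n) x).preimage_mem_nhds (Metric.ball_mem_nhds _ hr)]
      with y hy hy'
    have := hconst _ hy'
    rwa [Function.comp_apply, Function.comp_apply, he, (extChartAt (𝓡 n) x).left_inv hy,
      extChartAt_to_inv] at this
  obtain ⟨x₀⟩ := ‹Nonempty M›
  exact ⟨u x₀, fun x => hloc.apply_eq_of_preconnectedSpace x x₀⟩

end VectorFields

/-! ### Lie derivative of the metric along a rescaled field -/

section LieDerivative

variable {n : ℕ} {M : Type*} [TopologicalSpace M] [ChartedSpace (EuclideanSpace ℝ (Fin n)) M]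
  [IsManifold (𝓡 n) ∞ M]

theorem lieDerivMetric_smul (g : PseudoRiemannianMetric n M) {V : VField n M} {u : M → ℝ}
    (hu : ContMDiff (𝓡 n) 𝓘(ℝ, ℝ) ∞ u) (hV : IsSmoothField V) (X Y : VField n M) (x : M) :
    lieDerivMetric g (u • V) X Y x = u x * lieDerivMetric g V X Y x
      + dirDeriv X u x * g.inner x (V x) (Y x) + dirDeriv Y u x * g.inner x (X x) (V x) := by
  simp only [lieDerivMetric, bracket_smul_left _ hu hV, map_add, map_smul, neg_smul, map_neg,
    _root_.add_apply, _root_.neg_apply, _root_.smul_apply,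
    smul_eq_mul]
  simp only [dirDeriv, Pi.smul_apply', map_smul, smul_eq_mul]
  ring

end LieDerivative

/-! ### Paracontact geometry of the Reeb field -/

namespace AlmostParacontactMetric

variable {n : ℕ} {M : Type*} [TopologicalSpace M] [ChartedSpace (EuclideanSpace ℝ (Fin n)) M]
  [IsManifold (𝓡 n) ∞ M] (S : AlmostParacontactMetric n M)

theorem inner_ξ_left (x : M) (v : TangentSpace (𝓡 n) x) : S.g.inner x (S.ξ x) v = S.η x v := by
  have h := S.compatible x (S.ξ x) v
  rw [S.φ_ξ, map_zero, _root_.zero_apply, S.η_ξ] at h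
  linarith

theorem inner_ξ_right (x : M) (v : TangentSpace (𝓡 n) x) : S.g.inner x v (S.ξ x) = S.η x v := by
  rw [S.g.symm, inner_ξ_left]

theorem isSmoothField_φ {X : VField n M} (hX : IsSmoothField X) :
    IsSmoothField fun x => S.φ x (X x) :=
  S.smooth_φ.clm_bundle_apply hX

theorem contMDiff_η {X : VField n M} (hX : IsSmoothField X) :
    ContMDiff (𝓡 n) 𝓘(ℝ, ℝ) ∞ fun x => S.η x (X x) := by
  have h : ContMDiff (𝓡 n) ((𝓡 n).prod 𝓘(ℝ, ℝ)) ∞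
      (fun x => TotalSpace.mk' ℝ (E := Bundle.Trivial M ℝ) x (S.η x (X x))) :=
    ContMDiff.clm_bundle_apply (E₂ := Bundle.Trivial M ℝ) S.smooth_η hX
  intro x
  exact (contMDiffAt_totalSpace.1 (h x)).2

/-- In dimension at least two, `Φ` does not vanish on the contact distribution `ker η`. -/
theorem exists_inner_φ_ne_zero (hn : 2 ≤ n) (x : M) :
    ∃ v w : TangentSpace (𝓡 n) x, S.g.inner x (S.φ x v) (S.φ x (S.φ x w)) ≠ 0 := by
  by_contra! h
  have hφ : ∀ v, S.φ x v = 0 := by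
    refine fun v => S.g.nondegenerate x _ fun w => ?_
    -- The splitting `TM = im φ ⊕ ℝ ξ`: the form vanishes on the first part by assumption, on the
    -- second since `η ∘ φ = 0`.
    have hw : w = S.φ x (S.φ x w) + S.η x w • S.ξ x := by rw [S.φ_sq]; abel
    rw [hw, map_add, h, map_smul, inner_ξ_right, S.η_φ]
    simp
  have hspan : ∀ v, ∃ c : ℝ, c • S.ξ x = v := by
    refine fun v => ⟨S.η x v, ?_⟩
    have := S.φ_sq x v
    rw [hφ] at this
    exact (sub_eq_zero.1 this.symm).symm
  have hr : Module.finrank ℝ (TangentSpace (𝓡 n) x) = n :=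
    finrank_euclideanSpace_fin
  have := finrank_le_one (S.ξ x) hspan
  omega

variable {S}

/-- This is `L_ξ η = 0`: `dη(ξ, Y) = g(ξ, φY) = η(φY) = 0`, and `η(ξ)` is constant. -/
theorem IsParacontactMetric.dirDeriv_ξ_η (hS : S.IsParacontactMetric) {Y : VField n M}
    (hY : IsSmoothField Y) (x : M) :
    dirDeriv S.ξ (fun y => S.η y (Y y)) x = S.η x (bracket S.ξ Y x) := by
  have h := hS S.ξ Y S.smooth_ξ hY x
  have hc : dirDeriv Y (fun y => S.η y (S.ξ y)) x = 0 := by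
    simp only [S.η_ξ, dirDeriv_const]
  rw [fundamentalForm, extDerivOneForm, inner_ξ_left, S.η_φ, hc] at h
  linarith

theorem IsParacontactMetric.lieDerivMetric_ξ_ξ (hS : S.IsParacontactMetric) {Y : VField n M}
    (hY : IsSmoothField Y) (x : M) : lieDerivMetric S.g S.ξ S.ξ Y x = 0 := by
  have h0 : bracket S.ξ S.ξ x = 0 := by simp [bracket]
  simp only [lieDerivMetric, inner_ξ_left, hS.dirDeriv_ξ_η hY, h0]
  simp

/-- The Reeb field preserves the fundamental form, since `L_ξ η = 0` and `Φ = dη`. -/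
theorem IsParacontactMetric.dirDeriv_ξ_inner_φ [T2Space M] (hS : S.IsParacontactMetric)
    {X Y : VField n M} (hX : IsSmoothField X) (hY : IsSmoothField Y) (x : M) :
    dirDeriv S.ξ (fun y => S.g.inner y (X y) (S.φ y (Y y))) x
      = S.g.inner x (bracket S.ξ X x) (S.φ x (Y x))
        + S.g.inner x (X x) (S.φ x (bracket S.ξ Y x)) := by
  have hξ := S.smooth_ξ
  have hΦ : (fun y => S.g.inner y (X y) (S.φ y (Y y))) = fun y => (1 / 2 : ℝ) *
      (dirDeriv X (fun y => S.η y (Y y)) y - dirDeriv Y (fun y => S.η y (X y)) y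
        - S.η y (bracket X Y y)) := funext fun y => hS X Y hX hY y
  have h1 := contMDiff_dirDeriv hX (S.contMDiff_η hY)
  have h2 := contMDiff_dirDeriv hY (S.contMDiff_η hX)
  have h3 := S.contMDiff_η (hX.bracket hY)
  have hL : dirDeriv S.ξ (fun y => S.g.inner y (X y) (S.φ y (Y y))) x = (1 / 2 : ℝ) *
      (dirDeriv S.ξ (dirDeriv X (fun y => S.η y (Y y))) x
        - dirDeriv S.ξ (dirDeriv Y (fun y => S.η y (X y))) x
        - dirDeriv S.ξ (fun y => S.η y (bracket X Y y)) x) := by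
    rw [hΦ, dirDeriv_const_mul _ _ ((h1.sub h2).sub h3), dirDeriv_sub _ (h1.sub h2) h3,
      dirDeriv_sub _ h1 h2]
  have e1 := hS _ _ (hξ.bracket hX) hY x
  have e2 := hS _ _ hX (hξ.bracket hY) x
  rw [fundamentalForm, extDerivOneForm] at e1 e2
  rw [hL, e1, e2, hS.dirDeriv_ξ_η (hX.bracket hY), bracket_jacobi hξ hX hY, map_add,
    dirDeriv_bracket hξ hX (S.contMDiff_η hY), dirDeriv_bracket hξ hY (S.contMDiff_η hX),
    show dirDeriv S.ξ (fun y => S.η y (Y y)) = fun y => S.η y (bracket S.ξ Y y) from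
      funext (hS.dirDeriv_ξ_η hY),
    show dirDeriv S.ξ (fun y => S.η y (X y)) = fun y => S.η y (bracket S.ξ X y) from
      funext (hS.dirDeriv_ξ_η hX)]
  ring

/-- Invariance of `Φ` gives `(L_ξ g)(X, φY) = -2 g(X, hY)`; conclude by nondegeneracy. -/
theorem IsParacontactMetric.h_eq_zero_of_isKilling [T2Space M] (hS : S.IsParacontactMetric)
    (hK : IsKilling S.g S.ξ) {Y : VField n M} (hY : IsSmoothField Y) (x : M) : S.h Y x = 0 := by
  refine S.g.nondegenerate x _ fun w => ?_
  obtain ⟨X, hX, rfl⟩ := exists_isSmoothField_apply_eq x w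
  have h1 := hK X _ hX (S.isSmoothField_φ hY) x
  rw [lieDerivMetric, hS.dirDeriv_ξ_inner_φ hX hY] at h1
  rw [S.g.symm, AlmostParacontactMetric.h, map_smul, map_sub, smul_eq_mul]
  linarith

/-- If `du = (ξu) η` then `u` is constant along every vector field: applying `d` and restricting
to `ker η` gives `(ξu) dη = 0` there. -/
theorem IsParacontactMetric.dirDeriv_eq_zero [T2Space M] (hn : 2 ≤ n) (hS : S.IsParacontactMetric)
    {u : M → ℝ} (hu : ContMDiff (𝓡 n) 𝓘(ℝ, ℝ) ∞ u)
    (h : ∀ X : VField n M, IsSmoothField X →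
      ∀ x, dirDeriv X u x = dirDeriv S.ξ u x * S.η x (X x))
    {X : VField n M} (hX : IsSmoothField X) (x : M) : dirDeriv X u x = 0 := by
  obtain ⟨v, w, hvw⟩ := S.exists_inner_φ_ne_zero hn x
  obtain ⟨V, hV, rfl⟩ := exists_isSmoothField_apply_eq x v
  obtain ⟨W, hW, rfl⟩ := exists_isSmoothField_apply_eq x w
  have hφV := S.isSmoothField_φ hV
  have hφW := S.isSmoothField_φ hW
  have hzero : ∀ {U : VField n M} (hU : IsSmoothField U),
      dirDeriv (fun y => S.φ y (U y)) u = fun _ => 0 := by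
    intro U hU
    funext y
    rw [h _ (S.isSmoothField_φ hU), S.η_φ, mul_zero]
  have hb := dirDeriv_bracket hφV hφW hu x
  rw [hzero hV, hzero hW, dirDeriv_const, dirDeriv_const, h _ (hφV.bracket hφW), sub_zero] at hb
  have hd := hS _ _ hφV hφW x
  rw [fundamentalForm, extDerivOneForm] at hd
  -- On `ker η` only the bracket term of `dη` survives, so `Φ ≠ 0` forces `η([φV, φW]) ≠ 0`.
  simp only [S.η_φ, dirDeriv_const] at hd
  rw [h X hX, (mul_eq_zero.1 hb).resolve_right, zero_mul]
  intro h0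
  rw [h0] at hd
  exact hvw (by simpa using hd)

end AlmostParacontactMetric

end Paracontact

/-! ### The soliton equation -/

theorem mainTheorem2 {n : ℕ} (hn : 3 ≤ n) {M : Type*} [TopologicalSpace M] [T2Space M]
    [ConnectedSpace M] [ChartedSpace (EuclideanSpace ℝ (Fin n)) M] [IsManifold (𝓡 n) ∞ M]
    (S : Paracontact.AlmostParacontactMetric n M) (hS : S.IsParacontactMetric)
    (Z : Paracontact.VField n M) (lam δ : M → ℝ)
    (hsol : Paracontact.IsDeltaAlmostYamabeSoliton S.g Z lam δ)
    (f : M → ℝ) (hf : f ≠ 0) (hZ : ∀ x, Z x = f x • S.ξ x) :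
    (∀ x, Paracontact.scalarCurvature S.g x = lam x) ∧
      (∃ c : ℝ, ∀ x, f x = c) ∧
      Paracontact.IsKilling S.g S.ξ ∧
      S.IsKParacontact := by
  obtain rfl : Z = f • S.ξ := funext hZ
  have hξ := S.smooth_ξ
  -- Smoothness of `f` is inherited from `Z`, as `f = η(Z)`.
  have hfs : ContMDiff (𝓡 n) 𝓘(ℝ, ℝ) ∞ f := by
    simpa [S.η_ξ] using S.contMDiff_η hsol.smooth_Z
  have heq := hsol.equation
  simp only [Paracontact.lieDerivMetric_smul S.g hfs hξ, S.inner_ξ_left, S.inner_ξ_right] at heq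
  have hdf : ∀ X : Paracontact.VField n M, Paracontact.IsSmoothField X → ∀ x,
      Paracontact.dirDeriv X f x = Paracontact.dirDeriv S.ξ f x * S.η x (X x) := by
    intro X hX x
    have h1 := heq S.ξ S.ξ hξ hξ x
    have h2 := heq S.ξ X hξ hX x
    rw [hS.lieDerivMetric_ξ_ξ hξ, S.inner_ξ_left, S.η_ξ] at h1
    rw [hS.lieDerivMetric_ξ_ξ hX, S.inner_ξ_left, S.η_ξ] at h2
    have h3 : δ x * (Paracontact.dirDeriv X f x
        - Paracontact.dirDeriv S.ξ f x * S.η x (X x)) = 0 := by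
      linear_combination 2 * h2 - 2 * S.η x (X x) * h1
    linarith [(mul_eq_zero.1 h3).resolve_left (hsol.δ_ne_zero x)]
  have hdf0 : ∀ X : Paracontact.VField n M, Paracontact.IsSmoothField X → ∀ x,
      Paracontact.dirDeriv X f x = 0 :=
    fun X hX x => hS.dirDeriv_eq_zero (by omega) hfs hdf hX x
  have hr : ∀ x, Paracontact.scalarCurvature S.g x = lam x := by
    intro x
    have h1 := heq S.ξ S.ξ hξ hξ x
    rw [hS.lieDerivMetric_ξ_ξ hξ, S.inner_ξ_left, S.η_ξ, hdf0 _ hξ] at h1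
    linarith
  obtain ⟨c, hc⟩ := Paracontact.exists_eq_const_of_dirDeriv_eq_zero hfs hdf0
  have hc0 : c ≠ 0 := by
    rintro rfl
    exact hf (funext hc)
  have hK : Paracontact.IsKilling S.g S.ξ := by
    intro X Y hX hY x
    have h1 := heq X Y hX hY x
    rw [hdf0 X hX, hdf0 Y hY, hr, hc] at h1
    have h2 : (δ x * c) * Paracontact.lieDerivMetric S.g S.ξ X Y x = 0 := by
      linear_combination 2 * h1
    exact (mul_eq_zero.1 h2).resolve_left (mul_ne_zero (hsol.δ_ne_zero x) hc0)
  exact ⟨hr, ⟨c, hc⟩, hK, hS, fun X hX x => hS.h_eq_zero_of_isKilling hK hX x⟩
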